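/- Let $X$ be a finite set, let $p\ge 1$ be an integer, and let $(\mathcal M_\ell=(X_\ell,\mathcal I_\ell))_\ell$ be a $p$-matchoid on $X$: a collection of matroids with ground sets $X_\ell\subseteq X$ such that every $x\in X$ belongs to at most $p$ of the sets $X_\ell$. A set $S\subseteq X$ is independent ($S\in\mathcal I$) if $S\cap X_\ell\in\mathcal I_\ell$ for all $\ell$. Let $k$ be the rank of the matchoid, i.e. the maximum size of an independent set. Let $f:2^X\to\mathbb R_{\ge0}$ be monotone and submodular, write $f(x\mid S)=f(S\cup\{x\})-f(S)$, and let $\mathit{OPT}$ be a maximizer of $f$ over $\mathcal I$. Consider the procedure $\textsc{MultipassLocalSearch}(\alpha,\beta_1,\dots,\beta_d)$. Set $S_0=\emptyset$. For $i=1,\dots,d$, in the $i$-th pass every element of $X$ arrives exactly once, in an arbitrary order, which may differ from pass to pass. Let $\prec$ be the following order of pass $i$: all elements of $S_{i-1}$ come first, in the same relative order as in the order $\prec$ of pass $i-1$, followed by all elements of $X\setminus S_{i-1}$ in their order of arrival in pass $i$. For a set $S$ and $e\in S$ put $\nu(e,S)=f(e\mid\{t\in S:t\prec e\})$. The pass starts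 with $S=S_{i-1}$ and processes each arriving $x$ as follows. If $x\in S_{i-1}$, discard $x$. Otherwise, for each $\ell$ with $x\in X_\ell$ and $(S\cap X_\ell)\cup\{x\}\notin\mathcal I_\ell$, let $T_\ell=\{y\in S\cap X_\ell:((S\cap X_\ell)\setminus\{y\})\cup\{x\}\in\mathcal I_\ell\}$ and choose $c_\ell\in T_\ell$ minimizing $\nu(\cdot,S)$, ties being broken arbitrarily; let $C_x$ be the set of all the chosen $c_\ell$. (If some such $T_\ell$ is empty, which happens only if $x$ is a loop of $\mathcal M_\ell$, then $x$ is rejected.) If $f(x\mid S)\ge\alpha+(1+\beta_i)\sum_{c\in C_x}\nu(c,S)$, replace $S$ by $(S\setminus C_x)\cup\{x\}$; otherwise leave $S$ unchanged. At the end of the pass put $S_i=S$. Define $\gamma_1=4p$, $\beta_1=1$ and, for $i>1$, $$\gamma_i=4p\,\frac{\gamma_{i-1}(\gamma_{i-1}-1)}{(\gamma_{i-1}-1+p)^2},\qquad \beta_i=\frac{\gamma_{i-1}-1-p}{\gamma_{i-1}-1+p}.$$ Then, for every $d$, every choice of the arrival orders and every tie-breaking, $\textsc{MultipassLocalSearch}(0,\beta_1,\dots,\beta_d)$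 can be carried out, and for every $1\le i\le d$: the set $S_i$ is independent and $$\Bigl(p+1+\frac{4p}{i}\Bigr)f(S_i)\ \ge\ f(\mathit{OPT}).$$ In particular, for every $\varepsilon>0$, after any number $i\ge 4p/\varepsilon$ of passes, $(p+1+\varepsilon)f(S_i)\ge f(\mathit{OPT})$. Moreover, the algorithm stores only $O(k)$ elements: before and after each arrival its memory consists of the set $S_{i-1}$ at the start of the current pass and the current set $S$, both stored as lists in the order $\prec$, and these lists have total length at most $2k$. (While an arriving element $x$ is processed, $x$ itself is held in addition; $C_x$ and the $T_\ell$ are subsets of the stored set $S$.) -/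

import Mathlib

/-- `f : 2^X → ℝ` is submodular. -/
def IsSubmodular {X : Type*} [DecidableEq X] (f : Finset X → ℝ) : Prop :=
  ∀ A B : Finset X, f (A ∪ B) + f (A ∩ B) ≤ f A + f B

/-- A `p`-matchoid on `X`: a collection of matroids `M ℓ`, each defined on a subset `(M ℓ).E`
of `X`, such that every element lies in the ground sets of at most `p` of them. -/
def IsMatchoid {X ι : Type*} (p : ℕ) (M : ι → Matroid X) : Prop :=
  ∀ x : X, {l : ι | x ∈ (M l).E}.encard ≤ p

/-- Independence in the matchoid: `S ∩ X_ℓ` is independent in `M ℓ` for every `ℓ`. -/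
def Feasible {X ι : Type*} (M : ι → Matroid X) (S : Finset X) : Prop :=
  ∀ l : ι, (M l).Indep ((S : Set X) ∩ (M l).E)

/-- An optimal solution of the problem of maximizing `f` over the independent sets. -/
def IsOptimal {X ι : Type*} (f : Finset X → ℝ) (M : ι → Matroid X) (O : Finset X) : Prop :=
  Feasible M O ∧ ∀ T : Finset X, Feasible M T → f T ≤ f O

open Classical in
/-- The rank of a matchoid: the largest size of an independent set. -/
noncomputable def matchoidRank {X ι : Type*} [Fintype X] (M : ι → Matroid X) : ℕ :=
  (Finset.univ.filter fun S : Finset X => Feasible M S).sup Finset.card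

/-- The marginal value `f(x | S)`. -/
def marginal {X : Type*} [DecidableEq X] (f : Finset X → ℝ) (x : X) (S : Finset X) : ℝ :=
  f (insert x S) - f S

/-- The incremental value `ν(e, S) = f(e | {t ∈ S : t ≺ e})` of an element `e` of `S`. The set `S`
is given as the list of its elements in the order `≺`. -/
def incrementalValue {X : Type*} [DecidableEq X] (f : Finset X → ℝ) (S : List X) (e : X) : ℝ :=
  marginal f e (S.takeWhile fun t => t ≠ e).toFinset

/-- `x` belongs to `X_ℓ`, but cannot be added to `S_ℓ = S ∩ X_ℓ`. -/
def Blocked {X ι : Type*} (M : ι → Matroid X) (S : List X) (x : X) (l : ι) : Prop :=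
  x ∈ (M l).E ∧ ¬ (M l).Indep (insert x ({y | y ∈ S} ∩ (M l).E))

/-- The set `T_ℓ = {y ∈ S_ℓ : S_ℓ - y + x ∈ I_ℓ}`. -/
def exchangeCandidates {X ι : Type*} (M : ι → Matroid X) (S : List X) (x : X) (l : ι) : Set X :=
  {y | y ∈ {z | z ∈ S} ∩ (M l).E ∧ (M l).Indep (insert x (({z | z ∈ S} ∩ (M l).E) \ {y}))}

/-- `C` is a possible output of `Exchange(x, S)`: it consists of one element `c ℓ` of `T_ℓ` of
minimum incremental value for each `ℓ` that blocks `x`. Ties are broken arbitrarily. -/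
def IsExchange {X ι : Type*} [DecidableEq X] (f : Finset X → ℝ) (M : ι → Matroid X)
    (S : List X) (x : X) (C : Finset X) : Prop :=
  ∃ c : ι → X,
    (∀ l, Blocked M S x l → c l ∈ exchangeCandidates M S x l ∧
      ∀ t ∈ exchangeCandidates M S x l, incrementalValue f S (c l) ≤ incrementalValue f S t) ∧
    ∀ y, y ∈ C ↔ ∃ l, Blocked M S x l ∧ c l = y

/-- The memory of the streaming algorithm: the elements of the initial solution of the current pass
and those of the current solution, both as lists in the (pretend) order `≺` of the current pass:
the elements of the initial solution precede the elements accepted during the pass, the former are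
ordered as in the previous pass, the latter by time of arrival. -/
structure Memory (X : Type*) where
  init : List X
  sol : List X

/-- The number of elements of the stream that are stored. -/
def Memory.size {X : Type*} (m : Memory X) : ℕ := m.init.length + m.sol.length

/-- One step of `StreamingLocalSearch(α, β, S_init)`: `x` arrives and the memory changes from the
first argument to the last one. The case `noExchange` occurs only if `x` is a loop of some `M ℓ`,
so that `Exchange` cannot succeed and `x` is in no independent set. -/
inductive Step {X ι : Type*} [DecidableEq X] (f : Finset X → ℝ) (M : ι → Matroid X) (α β : ℝ) :
    Memory X → X → Memory X → Prop
  | discard (m : Memory X) (x : X) (hx : x ∈ m.init) : Step f M α β m x m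
  | accept (m : Memory X) (x : X) (C : Finset X) (hx : x ∉ m.init)
      (hC : IsExchange f M m.sol x C)
      (h : marginal f x m.sol.toFinset ≥ α + (1 + β) * ∑ c ∈ C, incrementalValue f m.sol c) :
      Step f M α β m x ⟨m.init, m.sol.filter (fun y => y ∉ C) ++ [x]⟩
  | reject (m : Memory X) (x : X) (C : Finset X) (hx : x ∉ m.init)
      (hC : IsExchange f M m.sol x C)
      (h : marginal f x m.sol.toFinset < α + (1 + β) * ∑ c ∈ C, incrementalValue f m.sol c) :
      Step f M α β m x m
  | noExchange (m : Memory X) (x : X) (hx : x ∉ m.init)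
      (h : ∃ l, Blocked M m.sol x l ∧ exchangeCandidates M m.sol x l = ∅) :
      Step f M α β m x m

/-- `StreamingLocalSearch(α, β, S_init)`, run on the stream `σ` of all elements of `X`, goes through
the memory states `mem 0, mem 1, …, mem |X|` (`mem t` is the state after `t` arrivals) and returns
`Sout`. -/
def IsStreamingLocalSearch {X ι : Type*} [Fintype X] [DecidableEq X] (f : Finset X → ℝ)
    (M : ι → Matroid X) (α β : ℝ) (σ : Fin (Fintype.card X) ≃ X) (Sinit : List X)
    (mem : ℕ → Memory X) (Sout : List X) : Prop :=
  mem 0 = ⟨Sinit, Sinit⟩ ∧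
  (∀ t : Fin (Fintype.card X), Step f M α β (mem t) (σ t) (mem (t + 1))) ∧
  (mem (Fintype.card X)).sol = Sout

/-- A run of `MultipassLocalSearch(α, β₁, …, β_d)`. The `i`-th pass (`1 ≤ i ≤ d`) reads the elements
in the order `σ i`, starts from `S (i-1)`, goes through the memory states `mem i t`, and returns
`S i`. -/
def IsMultipassLocalSearch {X ι : Type*} [Fintype X] [DecidableEq X] (f : Finset X → ℝ)
    (M : ι → Matroid X) (α : ℝ) (β : ℕ → ℝ) (d : ℕ) (σ : ℕ → (Fin (Fintype.card X) ≃ X))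
    (S : ℕ → List X) (mem : ℕ → ℕ → Memory X) : Prop :=
  S 0 = [] ∧
  ∀ i < d, IsStreamingLocalSearch f M α (β (i + 1)) (σ (i + 1)) (S i) (mem (i + 1)) (S (i + 1))

/-- The pretend stream order `≺` of the `i`-th pass: first the elements of `S (i-1)`, in their
pretend order in the previous pass, then the other elements, in the order of the stream. -/
def pretendOrder {X : Type*} [Fintype X] (σ : ℕ → (Fin (Fintype.card X) ≃ X)) (S : ℕ → List X) :
    ℕ → X → X → Prop
  | 0 => fun _ _ => False
  | i + 1 => fun u v =>
      (u ∈ S i ∧ v ∈ S i ∧ pretendOrder σ S i u v) ∨ (u ∈ S i ∧ v ∉ S i) ∨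
      (u ∉ S i ∧ v ∉ S i ∧ (σ (i + 1)).symm u < (σ (i + 1)).symm v)

/-- During every pass, the current solution is kept in the pretend stream order, so that
`incrementalValue` uses exactly that order. -/
theorem IsMultipassLocalSearch.pairwise_pretendOrder {X ι : Type*} [Fintype X] [DecidableEq X]
    {f : Finset X → ℝ} {M : ι → Matroid X} {α : ℝ} {β : ℕ → ℝ} {d : ℕ}
    {σ : ℕ → (Fin (Fintype.card X) ≃ X)} {S : ℕ → List X} {mem : ℕ → ℕ → Memory X}
    (h : IsMultipassLocalSearch f M α β d σ S mem) :
    ∀ i < d, ∀ t ≤ Fintype.card X,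
      (mem (i + 1) t).sol.Pairwise (pretendOrder σ S (i + 1)) := by
  obtain ⟨h0, hp⟩ := h
  have key : ∀ i < d, (S i).Pairwise (pretendOrder σ S i) → ∀ t ≤ Fintype.card X,
      (mem (i + 1) t).sol.Pairwise (pretendOrder σ S (i + 1)) ∧ (mem (i + 1) t).init = S i ∧
      ∀ y ∈ (mem (i + 1) t).sol, y ∈ S i ∨ ((σ (i + 1)).symm y : ℕ) < t := by
    intro i hi hS t
    obtain ⟨hm0, hstep, -⟩ := hp i hi
    induction t with
    | zero =>
      intro _
      rw [hm0]
      refine ⟨?_, rfl, fun y hy => Or.inl hy⟩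
      exact hS.imp_of_mem fun ha hb hab => Or.inl ⟨ha, hb, hab⟩
    | succ t ih =>
      intro ht
      obtain ⟨h1, h2, h3⟩ := ih (by omega)
      have hs := hstep ⟨t, by omega⟩
      simp only at hs
      have h3' : ∀ y ∈ (mem (i + 1) t).sol, y ∈ S i ∨ ((σ (i + 1)).symm y : ℕ) < t + 1 :=
        fun y hy => (h3 y hy).imp id (by omega)
      generalize hm' : mem (i + 1) (t + 1) = m' at hs
      generalize mem (i + 1) t = m at *
      generalize hx' : (σ (i + 1)) ⟨t, by omega⟩ = x at hs
      have hxt : (σ (i + 1)).symm x = ⟨t, by omega⟩ := by rw [← hx']; simp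
      cases hs with
      | discard => exact ⟨h1, h2, h3'⟩
      | reject => exact ⟨h1, h2, h3'⟩
      | noExchange => exact ⟨h1, h2, h3'⟩
      | accept C hx hC h =>
        refine ⟨?_, h2, ?_⟩
        · simp only
          rw [List.pairwise_append]
          refine ⟨h1.filter _, by simp, ?_⟩
          intro a ha b hb
          rw [List.mem_singleton] at hb
          subst hb
          rw [h2] at hx
          have ha' := List.mem_of_mem_filter ha
          by_cases haS : a ∈ S i
          · exact Or.inr (Or.inl ⟨haS, hx⟩)
          · refine Or.inr (Or.inr ⟨haS, hx, ?_⟩)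
            rw [hxt, Fin.lt_def]
            exact (h3 a ha').resolve_left haS
        · intro y hy
          rcases List.mem_append.1 hy with hy | hy
          · exact h3' y (List.mem_of_mem_filter hy)
          · rw [List.mem_singleton] at hy
            subst hy
            right
            rw [hxt]
            simp
  have hS : ∀ i ≤ d, (S i).Pairwise (pretendOrder σ S i) := by
    intro i
    induction i with
    | zero => intro _; rw [h0]; simp
    | succ i ih =>
      intro hi
      rw [← (hp i (by omega)).2.2]
      exact (key i (by omega) (ih (by omega)) _ le_rfl).1
  exact fun i hi t ht => (key i hi (hS i (by omega)) t ht).1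

/-! Within one pass, let `D` be the set of removed elements, each with the value `v` it had when
removed. An accepted element gains at least `1 + β` times the value it evicts, so `β * v(D)` is at
most the increase of `f` during the pass.

The marginal value of a rejected element is at most `1 + β` times the sum of one price per blocking
matroid. In each of these the element is spanned by elements worth at least that price. This
certificate survives later exchanges: if `y` is evicted on behalf of `M l`, it lies on a circuit of
`M l` whose other members (the newcomer and the other candidates) are worth at least as much, so
they replace `y` in the span. The removal of `y` is attributed to one such matroid only; in its
other matroids `y` keeps paying after removal.

At the end of the pass, fix a matroid and a threshold. The optimal elements charged there above the
threshold are independent and spanned by payers above it, so there are at most as many of them as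
such payers. Summed over thresholds, the charges in each matroid are at most the total value of its
payers. A kept element pays in at most `p` matroids and a removed one in at most `p - 1`, which
yields `PassInvariant.le_of_charged`.

Combining this bound with the ratio of the initial solution and eliminating the initial value gives
the recursion for `γ` (`ratio_step`). The excess of `γ i` over `p + 1` decays harmonically
(`approximationRatio_bounds`). -/

/-! ### Level-set comparison of sums and the recursion for the ratios -/

section Scalar

/-- If every upper level set of `w` on `R` is at most as large as that of `v` on `B`, then the sum
of `w` over `R` is at most that of `v` over `B`. -/
theorem sum_le_sum_of_card_level_le {X : Type*} [DecidableEq X] (w v : X → ℝ) :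
    ∀ (n : ℕ) (R B : Finset X), R.card = n → (∀ y ∈ B, 0 ≤ v y) →
      (∀ θ : ℝ, (R.filter fun x => θ ≤ w x).card ≤ (B.filter fun y => θ ≤ v y).card) →
      ∑ x ∈ R, w x ≤ ∑ y ∈ B, v y := by
  intro n
  induction n with
  | zero =>
    intro R B hR hv _
    rw [Finset.card_eq_zero.1 hR, Finset.sum_empty]
    exact Finset.sum_nonneg hv
  | succ n ih =>
    intro R B hR hv h
    -- Match a maximum `a` of `w` with any `b` of value at least `w a`. Erasing both lowers both
    -- level counts by one up to `w a`; above `w a` the level set of `R` is empty.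
    obtain ⟨a, ha, hmax⟩ := R.exists_max_image w (Finset.card_pos.1 (by omega))
    have hpos : 0 < (B.filter fun y => w a ≤ v y).card :=
      lt_of_lt_of_le (Finset.card_pos.2 ⟨a, by simp [ha]⟩) (h (w a))
    obtain ⟨b, hb⟩ := Finset.card_pos.1 hpos
    rw [Finset.mem_filter] at hb
    have hrec := ih (R.erase a) (B.erase b) (by rw [Finset.card_erase_of_mem ha, hR]; rfl)
      (fun y hy => hv y (Finset.mem_of_mem_erase hy)) (by
        intro θ
        rw [Finset.filter_erase, Finset.filter_erase]
        by_cases hθ : θ ≤ w a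
        · rw [Finset.card_erase_of_mem (by simp [ha, hθ]),
            Finset.card_erase_of_mem (by simp [hb.1, hθ.trans hb.2])]
          exact Nat.sub_le_sub_right (h θ) 1
        · have : (R.filter fun x => θ ≤ w x) = ∅ := by
            rw [Finset.filter_eq_empty_iff]
            exact fun x hx hx' => hθ (hx'.trans (hmax x hx))
          simp [this])
    rw [← Finset.add_sum_erase R w ha, ← Finset.add_sum_erase B v hb.1]
    linarith [hb.2]

/-- The recursion for the approximation ratios: the excess over `p + 1` stays positive and decays
like `4 * p / i`. -/
theorem approximationRatio_bounds {p : ℕ} (hp : 1 ≤ p) {γ : ℕ → ℝ} (hγ_one : γ 1 = 4 * p)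
    (hγ : ∀ i, 1 ≤ i → γ (i + 1) = 4 * p * (γ i * (γ i - 1) / (γ i - 1 + p) ^ 2))
    {i : ℕ} (hi : 1 ≤ i) : (p : ℝ) + 1 < γ i ∧ γ i ≤ p + 1 + 4 * p / i := by
  have hp' : (1 : ℝ) ≤ p := by exact_mod_cast hp
  induction i, hi using Nat.le_induction with
  | base =>
    rw [hγ_one]
    constructor
    · linarith
    · push_cast
      linarith
  | succ i hi ih =>
    obtain ⟨h1, h2⟩ := ih
    have hi' : (1 : ℝ) ≤ i := by exact_mod_cast hi
    obtain ⟨s, hs⟩ : ∃ s, s = γ i - 1 - p := ⟨_, rfl⟩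
    have hs0 : 0 < s := by linarith
    have hsi : s * i ≤ 4 * p := by
      rw [← le_div_iff₀ (by linarith)]
      linarith
    have hrec : γ (i + 1) = p + 1 + s * (4 * p ^ 2 + (3 * p - 1) * s) / (2 * p + s) ^ 2 := by
      rw [hγ i hi, show γ i = s + 1 + p by linarith]
      have : (2 * p + s) ≠ 0 := by positivity
      have : (s + 1 + p - 1 + p) ≠ 0 := by
        rw [show s + 1 + p - 1 + p = 2 * p + s by ring]
        assumption
      field_simp
      ring
    rw [hrec]
    have h3 : 0 < 4 * (p : ℝ) ^ 2 + (3 * p - 1) * s := by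
      have : 0 < (3 * (p : ℝ) - 1) * s := mul_pos (by linarith) hs0
      positivity
    refine ⟨lt_add_of_pos_right _ (by positivity), add_le_add le_rfl ?_⟩
    -- In reciprocals: the inverse of the excess grows by at least `1 / (4 * p)` in each pass.
    calc s * (4 * p ^ 2 + (3 * p - 1) * s) / (2 * p + s) ^ 2 ≤ 4 * p * s / (4 * p + s) := by
          rw [div_le_div_iff₀ (by positivity) (by positivity)]
          have h4 : (4 * (p : ℝ) ^ 2 + (3 * p - 1) * s) * (4 * p + s) ≤ 4 * p * (2 * p + s) ^ 2 := by
            nlinarith [mul_pos hs0 hs0, mul_pos (mul_pos hs0 hs0) (by linarith : (0:ℝ) < p),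
              mul_pos hs0 (by linarith : (0:ℝ) < p)]
          nlinarith [mul_le_mul_of_nonneg_left h4 hs0.le]
      _ ≤ 4 * p / ((i + 1 : ℕ) : ℝ) := by
          push_cast
          rw [div_le_div_iff₀ (by positivity) (by positivity)]
          nlinarith [mul_le_mul_of_nonneg_left hsi (by linarith : (0:ℝ) ≤ 4 * p)]

/-- The guarantee of one pass with the parameter `β` adapted to the ratio `g` of the initial
solution. Here `o`, `s`, `s₀` are the values of the optimum, the new and the initial solution. -/
theorem ratio_step {p g β o s s₀ : ℝ} (hp : 1 ≤ p) (hg : p + 1 < g)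
    (hβ : β = (g - 1 - p) / (g - 1 + p)) (h₀ : o ≤ g * s₀)
    (h : o ≤ (1 + p + p * β) * s + (p / β + p - 1) * (s - s₀)) :
    o ≤ 4 * p * (g * (g - 1) / (g - 1 + p) ^ 2) * s := by
  obtain ⟨a, ha⟩ : ∃ a, a = g - 1 - p := ⟨_, rfl⟩
  have ha0 : 0 < a := by linarith
  have hg' : g = a + 1 + p := by linarith
  have hb : g - 1 + p = a + 2 * p := by linarith
  rw [← ha, hb] at hβ
  have hq : 0 < a + 2 * p := by positivity
  have hpβ : p / β = p * (a + 2 * p) / a := by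
    rw [hβ]
    field_simp
  rw [hpβ] at h
  have hc : 0 < p * (a + 2 * p) / a + p - 1 := by
    have : 0 < p * (a + 2 * p) / a := by positivity
    linarith
  have h1 := mul_le_mul_of_nonneg_left h₀ hc.le
  have h2 := mul_le_mul_of_nonneg_left h (by linarith : 0 ≤ g)
  -- Adding `h1` and `h2` cancels `s₀`. The prescribed `β` is the one minimizing the resulting
  -- ratio.
  have h3 : (p * (a + 2 * p) / a + p - 1 + g) * o ≤
      g * (1 + p + p * β + (p * (a + 2 * p) / a + p - 1)) * s := by
    nlinarith
  have e1 : p * (a + 2 * p) / a + p - 1 + g = (a + 2 * p) * (a + p) / a := by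
    rw [hg']
    field_simp
    ring
  have e2 : 1 + p + p * β + (p * (a + 2 * p) / a + p - 1) =
      4 * p * (a + p) ^ 2 / (a * (a + 2 * p)) := by
    rw [hβ]
    field_simp
    ring
  rw [e1, e2] at h3
  have hk : 0 < (a + 2 * p) * (a + p) / a := by positivity
  refine le_of_mul_le_mul_left (h3.trans (le_of_eq ?_)) hk
  rw [hb, show g - 1 = a + p by linarith]
  field_simp

end Scalar

/-! ### Marginal and incremental values of a monotone submodular function -/

section Submodular

variable {X : Type*} [DecidableEq X] {f : Finset X → ℝ}

theorem marginal_antitone (hmono : Monotone f) (hsub : IsSubmodular f) {A B : Finset X}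
    (h : A ⊆ B) (x : X) : marginal f x B ≤ marginal f x A := by
  unfold marginal
  have h1 := hsub (insert x A) B
  have h2 : insert x A ∪ B = insert x B := by
    rw [Finset.insert_union, Finset.union_eq_right.2 h]
  have h3 : f A ≤ f (insert x A ∩ B) :=
    hmono (Finset.subset_inter (Finset.subset_insert _ _) h)
  rw [h2] at h1
  linarith

theorem marginal_nonneg (hmono : Monotone f) (x : X) (A : Finset X) : 0 ≤ marginal f x A :=
  sub_nonneg.2 (hmono (Finset.subset_insert _ _))

theorem le_add_sum_marginal (hmono : Monotone f) (hsub : IsSubmodular f) (A O : Finset X) :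
    f (A ∪ O) ≤ f A + ∑ o ∈ O, marginal f o A := by
  induction O using Finset.induction_on with
  | empty => simp
  | insert x O hx ih =>
    rw [Finset.sum_insert hx, Finset.union_insert]
    have := marginal_antitone hmono hsub (Finset.subset_union_left (s₁ := A) (s₂ := O)) x
    have h : f (insert x (A ∪ O)) = marginal f x (A ∪ O) + f (A ∪ O) := by simp [marginal]
    linarith

theorem incrementalValue_nonneg (hmono : Monotone f) (S : List X) (e : X) :
    0 ≤ incrementalValue f S e :=
  marginal_nonneg hmono _ _

theorem incrementalValue_append_of_mem {S T : List X} {e : X} (he : e ∈ S) :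
    incrementalValue f (S ++ T) e = incrementalValue f S e := by
  unfold incrementalValue
  congr 2
  induction S with
  | nil => simp at he
  | cons a S ih =>
    by_cases h : a = e
    · simp [h]
    · have : e ∈ S := by simpa [Ne.symm h] using he
      simp [h] at ih ⊢
      exact ih this

theorem incrementalValue_append_self {S : List X} {x : X} (hx : x ∉ S) :
    incrementalValue f (S ++ [x]) x = marginal f x S.toFinset := by
  unfold incrementalValue
  congr 2
  induction S with
  | nil => simp
  | cons a S ih =>
    simp only [List.mem_cons, not_or] at hx
    simp [Ne.symm hx.1] at ih ⊢
    exact ih hx.2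

/-- Deleting elements shrinks the prefix before `e`. Hence the value of an element never drops while
it stays in the solution. -/
theorem incrementalValue_le_filter (hmono : Monotone f) (hsub : IsSubmodular f) (S : List X)
    (q : X → Bool) {e : X} (he : q e) :
    incrementalValue f S e ≤ incrementalValue f (S.filter q) e := by
  refine marginal_antitone hmono hsub ?_ e
  induction S with
  | nil => simp
  | cons a S ih =>
    by_cases h : a = e
    · subst h
      simp [he]
    · by_cases hq : q a
      · simp only [List.filter_cons, hq, if_true, List.takeWhile_cons, h, ne_eq, not_false_eq_true,
          decide_true, List.toFinset_cons]
        exact Finset.insert_subset_insert _ ih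
      · simp only [List.filter_cons, hq, if_false, List.takeWhile_cons, h, ne_eq,
          not_false_eq_true, decide_true, List.toFinset_cons, Bool.false_eq_true, if_true]
        exact ih.trans (Finset.subset_insert _ _)

theorem sum_incrementalValue {S : List X} (hS : S.Nodup) :
    ∑ e ∈ S.toFinset, incrementalValue f S e = f S.toFinset - f ∅ := by
  induction S using List.reverseRecOn with
  | nil => simp
  | append_singleton S x ih =>
    rw [List.nodup_append] at hS
    have hx : x ∉ S := fun h => hS.2.2 x h x (by simp) rfl
    have hx' : x ∉ S.toFinset := by simpa using hx
    rw [show (S ++ [x]).toFinset = insert x S.toFinset by ext; simp,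
      Finset.sum_insert hx', incrementalValue_append_self hx,
      Finset.sum_congr rfl fun e he => incrementalValue_append_of_mem (List.mem_toFinset.1 he),
      ih hS.1, marginal]
    ring

/-- Rebuild `S` in list order: a member of `C` contributes its incremental value, and any other
element contributes no more than it does over the smaller filtered prefix. This bounds the loss
caused by an eviction. -/
theorem le_filter_add_sum_incrementalValue (hmono : Monotone f) (hsub : IsSubmodular f)
    {S : List X} (hS : S.Nodup) (C : Finset X) :
    f S.toFinset ≤ f (S.filter fun y => y ∉ C).toFinset +
      ∑ c ∈ S.toFinset.filter (· ∈ C), incrementalValue f S c := by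
  induction S using List.reverseRecOn with
  | nil => simp
  | append_singleton S x ih =>
    rw [List.nodup_append] at hS
    have hx : x ∉ S := fun h => hS.2.2 x h x (by simp) rfl
    have hsum : ∑ c ∈ S.toFinset.filter (· ∈ C), incrementalValue f (S ++ [x]) c =
        ∑ c ∈ S.toFinset.filter (· ∈ C), incrementalValue f S c :=
      Finset.sum_congr rfl fun e he =>
        incrementalValue_append_of_mem (List.mem_toFinset.1 (Finset.mem_filter.1 he).1)
    have ih := ih hS.1
    rw [show (S ++ [x]).toFinset = insert x S.toFinset by ext; simp]
    by_cases hC : x ∈ C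
    · rw [Finset.filter_insert, if_pos hC, Finset.sum_insert (by simp [hx]), hsum,
        incrementalValue_append_self hx, List.filter_append]
      simp only [marginal, hC, not_true_eq_false, decide_false, List.filter_cons, if_false,
        List.filter_nil, List.append_nil, Bool.false_eq_true]
      linarith
    · rw [Finset.filter_insert, if_neg hC, hsum, List.filter_append,
        show (S.filter (fun y => y ∉ C) ++ [x].filter (fun y => y ∉ C)).toFinset =
          insert x (S.filter fun y => y ∉ C).toFinset by ext; simp [hC]]
      have := marginal_antitone hmono hsub (A := (S.filter fun y => y ∉ C).toFinset)
        (B := S.toFinset) (fun y => by simp +contextual) x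
      unfold marginal at this
      linarith

end Submodular

/-! ### Spans, fundamental circuits and feasibility of exchanges -/

section Matroid

open Set

/-- If the independent elements of `R` with `w ≥ θ` are spanned by elements of `B` with `v ≥ θ`,
then `w` on `R` sums to at most `v` on `B`. -/
theorem Matroid.Indep.sum_le_sum_of_mem_closure {X : Type*} [DecidableEq X] {N : Matroid X}
    {R B : Finset X} {w v : X → ℝ} (hR : N.Indep (R : Set X)) (hv : ∀ y ∈ B, 0 ≤ v y)
    (h : ∀ x ∈ R, x ∈ N.closure {y | y ∈ B ∧ w x ≤ v y}) :
    ∑ x ∈ R, w x ≤ ∑ y ∈ B, v y := by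
  refine sum_le_sum_of_card_level_le w v _ R B rfl hv fun θ => ?_
  have hI : N.Indep ((R.filter fun x => θ ≤ w x : Finset X) : Set X) :=
    hR.subset (Finset.coe_subset.2 (Finset.filter_subset _ _))
  have hsub : ((R.filter fun x => θ ≤ w x : Finset X) : Set X) ⊆
      N.closure ((B.filter fun y => θ ≤ v y : Finset X) : Set X) := by
    intro x hx
    simp only [Finset.coe_filter, mem_ofPred_eq] at hx
    refine N.closure_subset_closure ?_ (h x hx.1)
    intro y hy
    simpa using ⟨hy.1, hx.2.trans hy.2⟩
  have := N.eRk_mono hsub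
  rw [hI.eRk_eq_encard, N.eRk_closure_eq] at this
  have := this.trans (N.eRk_le_encard _)
  rwa [encard_coe_eq_coe_finsetCard, encard_coe_eq_coe_finsetCard, Nat.cast_le] at this

variable {X ι : Type*} {M : ι → Matroid X} {S : List X} {x : X} {l : ι}

/-- The candidates are exactly the fundamental circuit of `x` without `x`. Both spanning statements
below are read off from it. -/
theorem Blocked.exists_isCircuit (hS : (M l).Indep ({y | y ∈ S} ∩ (M l).E))
    (hx : Blocked M S x l) :
    (M l).IsCircuit (insert x (exchangeCandidates M S x l)) ∧
      x ∉ exchangeCandidates M S x l := by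
  have hxS : x ∉ {y | y ∈ S} ∩ (M l).E := fun h => hx.2 (by rwa [insert_eq_of_mem h])
  have hcl : x ∈ (M l).closure ({y | y ∈ S} ∩ (M l).E) := by
    by_contra h
    exact hx.2 ((hS.notMem_closure_iff_of_notMem hxS hx.1).1 h)
  refine ⟨?_, fun h => hxS h.1⟩
  have he : (M l).fundCircuit x ({y | y ∈ S} ∩ (M l).E) =
      insert x (exchangeCandidates M S x l) := by
    ext y
    by_cases hy : y = x
    · subst hy
      simp [Matroid.mem_fundCircuit]
    · rw [hS.mem_fundCircuit_iff hcl hxS, mem_insert_iff, or_iff_right hy,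
        ← insert_sdiff_singleton_comm (Ne.symm hy)]
      refine ⟨fun h => ⟨?_, h⟩, fun h => h.2⟩
      by_contra hy'
      rw [sdiff_singleton_eq_self hy'] at h
      exact hx.2 h
  rw [← he]
  exact hS.fundCircuit_isCircuit hcl hxS

theorem Blocked.mem_closure (hS : (M l).Indep ({y | y ∈ S} ∩ (M l).E)) (hx : Blocked M S x l) :
    x ∈ (M l).closure (exchangeCandidates M S x l) := by
  obtain ⟨h, hx'⟩ := hx.exists_isCircuit hS
  have := h.mem_closure_sdiff_singleton_of_mem (mem_insert _ _)
  rwa [insert_sdiff_self_of_notMem hx'] at this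

theorem Blocked.mem_closure_of_mem (hS : (M l).Indep ({y | y ∈ S} ∩ (M l).E))
    (hx : Blocked M S x l) {c : X} (hc : c ∈ exchangeCandidates M S x l) :
    c ∈ (M l).closure (insert x (exchangeCandidates M S x l \ {c})) := by
  obtain ⟨h, hx'⟩ := hx.exists_isCircuit hS
  have := h.mem_closure_sdiff_singleton_of_mem (mem_insert_of_mem _ hc)
  rwa [← insert_sdiff_singleton_comm (fun h : x = c => hx' (Set.mem_of_eq_of_mem h hc))] at this

theorem Feasible.accept [DecidableEq X] {f : Finset X → ℝ} {C : Finset X}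
    (hS : Feasible M S.toFinset) (hC : IsExchange f M S x C) :
    Feasible M (S.filter (fun y => y ∉ C) ++ [x]).toFinset := by
  obtain ⟨c, hc, hC⟩ := hC
  intro l
  have hS := hS l
  by_cases hx : x ∈ (M l).E
  · by_cases hb : Blocked M S x l
    · refine (hc l hb).1.2.subset ?_
      rintro y ⟨hy, hyE⟩
      simp only [List.coe_toFinset, List.mem_append, List.mem_filter, decide_eq_true_eq,
        List.mem_singleton, mem_ofPred_eq] at hy
      rcases hy with hy | hy
      · exact Or.inr ⟨⟨hy.1, hyE⟩, fun h => hy.2 ((hC y).2 ⟨l, hb, h.symm⟩)⟩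
      · exact Or.inl hy
    · have hI : (M l).Indep (insert x ({y | y ∈ S} ∩ (M l).E)) := by
        by_contra h
        exact hb ⟨hx, h⟩
      refine hI.subset ?_
      rintro y ⟨hy, hyE⟩
      simp only [List.coe_toFinset, List.mem_append, List.mem_filter, decide_eq_true_eq,
        List.mem_singleton, mem_ofPred_eq] at hy
      exact hy.elim (fun h => Or.inr ⟨h.1, hyE⟩) Or.inl
  · refine hS.subset ?_
    rintro y ⟨hy, hyE⟩
    simp only [List.coe_toFinset, List.mem_append, List.mem_filter, decide_eq_true_eq,
      List.mem_singleton, mem_ofPred_eq] at hy ⊢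
    exact ⟨hy.elim (fun h => h.1) (fun h => absurd (h ▸ hyE) hx), hyE⟩

theorem IsMatchoid.finite_setOf_mem {p : ℕ} (hM : IsMatchoid p M) (x : X) :
    {l | x ∈ (M l).E}.Finite :=
  finite_of_encard_le_coe (hM x)

theorem IsMatchoid.card_le {p : ℕ} (hM : IsMatchoid p M) {J : Finset ι}
    (h : ∀ l ∈ J, x ∈ (M l).E) : J.card ≤ p := by
  have : (J : Set ι).encard ≤ p := (encard_le_encard h).trans (hM x)
  rwa [encard_coe_eq_coe_finsetCard, Nat.cast_le] at this

end Matroid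

/-! ### The charging argument within one pass -/

section Pass

variable {X ι : Type*}

/-- The elements of `M l` that can pay for rejections by `M l`, at a price of at least `θ`: those of
the current solution `S`, and the removed elements `D` whose removal is not attributed to `l`. -/
def payers (M : ι → Matroid X) (S : List X) (D : Finset X) (v : X → ℝ) (ρ : X → Option ι) (l : ι)
    (θ : ℝ) : Set X :=
  {y | y ∈ (M l).E ∧ (y ∈ S ∨ y ∈ D ∧ ρ y ≠ some l) ∧ θ ≤ v y}

/-- The marginal value of `x` is paid for by elements that span it in the matroids blocking it. -/
def Charged [DecidableEq X] (f : Finset X → ℝ) (M : ι → Matroid X) (β : ℝ) (S : List X)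
    (D : Finset X) (v : X → ℝ) (ρ : X → Option ι) (x : X) : Prop :=
  ∃ (B : Finset ι) (w : ι → ℝ), marginal f x (S.toFinset ∪ D) ≤ (1 + β) * ∑ l ∈ B, w l ∧
    ∀ l ∈ B, x ∈ (M l).closure (payers M S D v ρ l (w l))

/-- The state of a pass with initial solution `S₀` and current solution `S`: `D` is the set of
removed elements, `v` gives the incremental values of the elements of `S` and the values that
the elements of `D` had upon removal, and `ρ` names a matroid responsible for each removal. -/
structure PassInvariant [DecidableEq X] (f : Finset X → ℝ) (M : ι → Matroid X) (β : ℝ)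
    (S₀ S : List X) (D : Finset X) (v : X → ℝ) (ρ : X → Option ι) : Prop where
  nodup : S.Nodup
  feasible : Feasible M S.toFinset
  disjoint : ∀ y ∈ S, y ∉ D
  value : ∀ y ∈ S, v y = incrementalValue f S y
  nonneg : ∀ y ∈ D, 0 ≤ v y
  removed : ∀ y ∈ D, ∃ l, ρ y = some l ∧ y ∈ (M l).E
  union_le : f (S.toFinset ∪ D) ≤ f S.toFinset + ∑ y ∈ D, v y
  gain : β * ∑ y ∈ D, v y ≤ f S.toFinset - f S₀.toFinset

variable [DecidableEq X] {f : Finset X → ℝ} {M : ι → Matroid X} {β : ℝ} {S₀ S S' : List X}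
  {D D' : Finset X} {v v' : X → ℝ} {ρ ρ' : X → Option ι} {x : X}

theorem PassInvariant.refl (h : S.Nodup) (hS : Feasible M S.toFinset) (ρ : X → Option ι) :
    PassInvariant f M β S S ∅ (incrementalValue f S) ρ where
  nodup := h
  feasible := hS
  disjoint := by simp
  value := by simp
  nonneg := by simp
  removed := by simp
  union_le := by simp
  gain := by simp

theorem Charged.mono (hmono : Monotone f) (hsub : IsSubmodular f)
    (h : Charged f M β S D v ρ x) (hSD : S.toFinset ∪ D ⊆ S'.toFinset ∪ D')
    (hp : ∀ l θ, payers M S D v ρ l θ ⊆ (M l).closure (payers M S' D' v' ρ' l θ)) :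
    Charged f M β S' D' v' ρ' x := by
  obtain ⟨B, w, h1, h2⟩ := h
  exact ⟨B, w, (marginal_antitone hmono hsub hSD x).trans h1, fun l hl =>
    (M l).closure_subset_closure_of_subset_closure (hp l (w l)) (h2 l hl)⟩

theorem IsExchange.subset {C : Finset X} (hC : IsExchange f M S x C) {y : X} (hy : y ∈ C) :
    y ∈ S := by
  obtain ⟨c, hc, hC⟩ := hC
  obtain ⟨l, hl, rfl⟩ := (hC y).1 hy
  exact (hc l hl).1.1.1

theorem PassInvariant.charged_of_reject {p : ℕ} (hM : IsMatchoid p M) (hmono : Monotone f)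
    (hsub : IsSubmodular f) (hβ : 0 ≤ β) (h : PassInvariant f M β S₀ S D v ρ) {C : Finset X}
    (hC : IsExchange f M S x C)
    (hx : marginal f x S.toFinset ≤ (1 + β) * ∑ c ∈ C, incrementalValue f S c) :
    Charged f M β S D v ρ x := by
  classical
  obtain ⟨c, hc, hC⟩ := hC
  have hfin : {l | Blocked M S x l}.Finite := (hM.finite_setOf_mem x).subset fun l hl => hl.1
  refine ⟨hfin.toFinset, fun l => incrementalValue f S (c l), ?_, ?_⟩
  · refine (marginal_antitone hmono hsub Finset.subset_union_left x).trans (hx.trans ?_)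
    refine mul_le_mul_of_nonneg_left ?_ (by linarith)
    have : C = hfin.toFinset.image c := by
      ext y
      simp [hC]
    rw [this]
    exact Finset.sum_image_le_of_nonneg fun l _ => incrementalValue_nonneg hmono S _
  · intro l hl
    have hl : Blocked M S x l := by simpa using hl
    have hS : (M l).Indep ({y | y ∈ S} ∩ (M l).E) := by simpa using h.feasible l
    -- The price in `M l` is the minimum value over the candidates, so every candidate can pay it,
    -- and together they span `x`.
    refine (M l).closure_subset_closure ?_ (hl.mem_closure hS)
    intro t ht
    refine ⟨ht.1.2, Or.inl ht.1.1, ?_⟩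
    rw [h.value t ht.1.1]
    exact (hc l hl).2 t ht

/-- The span inclusion for payers is what keeps earlier charges valid: a payer lost by `M l` is
spanned by payers at the same threshold after the exchange. -/
theorem PassInvariant.accept (hmono : Monotone f) (hsub : IsSubmodular f) (hβ : 0 ≤ β)
    (h : PassInvariant f M β S₀ S D v ρ) {C : Finset X} (hC : IsExchange f M S x C)
    (hx : (1 + β) * ∑ c ∈ C, incrementalValue f S c ≤ marginal f x S.toFinset)
    (hxS : x ∉ S) (hxD : x ∉ D) :
    ∃ v' ρ', PassInvariant f M β S₀ (S.filter (fun y => y ∉ C) ++ [x]) (D ∪ C) v' ρ' ∧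
      ∀ l θ, payers M S D v ρ l θ ⊆
        (M l).closure (payers M (S.filter (fun y => y ∉ C) ++ [x]) (D ∪ C) v' ρ' l θ) := by
  classical
  have hfeas := h.feasible.accept hC
  have hCS : ∀ y ∈ C, y ∈ S := fun y hy => hC.subset hy
  obtain ⟨c, hc, hCc⟩ := hC
  have hxC : x ∉ C := fun hx => hxS (hCS x hx)
  obtain ⟨S', hS'⟩ : ∃ S', S' = S.filter (fun y => y ∉ C) ++ [x] := ⟨_, rfl⟩
  have hmem : ∀ y, y ∈ S' ↔ (y ∈ S ∧ y ∉ C) ∨ y = x := by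
    intro y
    simp [hS']
  have hfil : ∀ y ∈ S, y ∉ C → incrementalValue f S y ≤ incrementalValue f S' y := by
    intro y hy hyC
    rw [hS', incrementalValue_append_of_mem (by simp [hy, hyC])]
    exact incrementalValue_le_filter hmono hsub S _ (by simpa using hyC)
  have hxv : marginal f x S.toFinset ≤ incrementalValue f S' x := by
    rw [hS', incrementalValue_append_self (by simp [hxS])]
    exact marginal_antitone hmono hsub (fun y => by simp +contextual) x
  have hvC : ∑ y ∈ C, v y = ∑ y ∈ C, incrementalValue f S y :=
    Finset.sum_congr rfl fun y hy => h.value y (hCS y hy)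
  have hDC : Disjoint D C :=
    Finset.disjoint_left.2 fun y hy hyC => h.disjoint y (hCS y hyC) hy
  have hloss : f S.toFinset ≤ f (S.filter fun y => y ∉ C).toFinset + ∑ y ∈ C, v y := by
    have := le_filter_add_sum_incrementalValue hmono hsub h.nodup C
    rwa [show S.toFinset.filter (· ∈ C) = C by
      ext y; simpa using fun hy => hCS y hy, ← hvC] at this
  have hSx : S'.toFinset = insert x (S.filter fun y => y ∉ C).toFinset := by
    ext y
    simp [hS']
  have hgain : f S.toFinset + marginal f x S.toFinset ≤ f S'.toFinset + ∑ y ∈ C, v y := by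
    have := marginal_antitone hmono hsub (A := (S.filter fun y => y ∉ C).toFinset)
      (B := S.toFinset) (fun y => by simp +contextual) x
    rw [hSx]
    unfold marginal at this ⊢
    linarith
  -- Values of kept elements are updated; those of evicted elements are frozen.
  let v' : X → ℝ := fun y => if y ∈ S' then incrementalValue f S' y else v y
  have hv'D : ∀ y ∈ D ∪ C, v' y = v y := by
    intro y hy
    refine if_neg fun hyS => ?_
    rw [hmem] at hyS
    rw [Finset.mem_union] at hy
    rcases hyS with hyS | rfl
    · exact hy.elim (h.disjoint y hyS.1) hyS.2
    · exact hy.elim hxD hxC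
  have hρ : ∀ y ∈ C, ∃ l, Blocked M S x l ∧ c l = y := fun y hy => (hCc y).1 hy
  -- An element may be chosen by several matroids; only one of them is held responsible, and the
  -- others retain it as a payer.
  let ρ' : X → Option ι := fun y => if hy : y ∈ C then some (hρ y hy).choose else ρ y
  have hρC : ∀ y ∈ C, ∃ l, ρ' y = some l ∧ Blocked M S x l ∧ c l = y := by
    intro y hy
    exact ⟨_, dif_pos hy, (hρ y hy).choose_spec⟩
  have hρD : ∀ y, y ∉ C → ρ' y = ρ y := fun y hy => dif_neg hy
  have hsum : ∑ y ∈ D ∪ C, v' y = ∑ y ∈ D, v y + ∑ y ∈ C, v y := by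
    rw [Finset.sum_congr rfl hv'D, Finset.sum_union hDC]
  rw [← hS'] at hfeas ⊢
  refine ⟨v', ρ', ⟨?_, hfeas, ?_, ?_, ?_, ?_, ?_, ?_⟩, ?_⟩
  · rw [hS', List.nodup_append]
    refine ⟨h.nodup.filter _, by simp, ?_⟩
    intro a ha b hb hab
    rw [List.mem_singleton] at hb
    exact hxS (hb ▸ hab ▸ List.mem_of_mem_filter ha)
  · intro y hy hyD
    rw [hmem] at hy
    rw [Finset.mem_union] at hyD
    rcases hy with hy | rfl
    · exact hyD.elim (h.disjoint y hy.1) hy.2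
    · exact hyD.elim hxD hxC
  · exact fun y hy => if_pos hy
  · intro y hy
    rw [hv'D y hy]
    rcases Finset.mem_union.1 hy with hy | hy
    · exact h.nonneg y hy
    · rw [h.value y (hCS y hy)]
      exact incrementalValue_nonneg hmono S y
  · intro y hy
    by_cases hyC : y ∈ C
    · obtain ⟨l, hl, hb, hcl⟩ := hρC y hyC
      have h2 := (hc _ hb).1.1.2
      rw [hcl] at h2
      exact ⟨l, hl, h2⟩
    · rw [hρD y hyC]
      exact h.removed y ((Finset.mem_union.1 hy).resolve_right hyC)
  · have e : S'.toFinset ∪ (D ∪ C) = insert x (S.toFinset ∪ D) := by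
      ext y
      simp only [Finset.mem_union, List.mem_toFinset, hmem, Finset.mem_insert]
      have := hCS y
      tauto
    have h1 := marginal_antitone hmono hsub
      (Finset.subset_union_left (s₁ := S.toFinset) (s₂ := D)) x
    have h2 := h.union_le
    have h3 : f (insert x (S.toFinset ∪ D)) =
      marginal f x (S.toFinset ∪ D) + f (S.toFinset ∪ D) := by simp [marginal]
    rw [e, hsum]
    linarith
  · have := h.gain
    rw [hsum]
    rw [← hvC] at hx
    linarith
  · intro l θ y hy
    obtain ⟨hyE, hyS, hyθ⟩ := hy
    have hS : (M l).Indep ({y | y ∈ S} ∩ (M l).E) := by simpa using h.feasible l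
    have hground : payers M S' (D ∪ C) v' ρ' l θ ⊆ (M l).E := fun z hz => hz.1
    have old : ∀ z ∈ S, z ∈ (M l).E → θ ≤ v z → (z ∈ C → ρ' z ≠ some l) →
        z ∈ payers M S' (D ∪ C) v' ρ' l θ := by
      intro z hz hzE hzθ hzC
      by_cases hzC' : z ∈ C
      · refine ⟨hzE, Or.inr ⟨Finset.mem_union_right _ hzC', hzC hzC'⟩, ?_⟩
        rwa [hv'D z (Finset.mem_union_right _ hzC')]
      · have hzS' : z ∈ S' := (hmem z).2 (Or.inl ⟨hz, hzC'⟩)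
        refine ⟨hzE, Or.inl hzS', ?_⟩
        rw [h.value z hz] at hzθ
        simp only [v', if_pos hzS']
        exact hzθ.trans (hfil z hz hzC')
    -- Only in this case does `y` stop paying for `M l`; the rest of its circuit then takes over.
    by_cases hyC : y ∈ C ∧ ρ' y = some l
    · obtain ⟨hyC, hyl⟩ := hyC
      obtain ⟨l', hl', hb, hcy⟩ := hρC y hyC
      obtain rfl : l = l' := Option.some_injective _ (hyl.symm.trans hl')
      obtain ⟨hT, hmin⟩ := hc _ hb
      rw [hcy] at hT hmin
      refine (M _).closure_subset_closure ?_ (hb.mem_closure_of_mem hS hT)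
      rw [h.value y (hCS y hyC)] at hyθ
      rintro t (rfl | ht)
      · have hxS' : t ∈ S' := (hmem t).2 (Or.inr rfl)
        refine ⟨hb.1, Or.inl hxS', ?_⟩
        simp only [v', if_pos hxS']
        refine le_trans ?_ hxv
        refine le_trans ?_ hx
        have h1 : incrementalValue f S y ≤ ∑ c ∈ C, incrementalValue f S c :=
          Finset.single_le_sum (fun z _ => incrementalValue_nonneg hmono S z) hyC
        have h2 := incrementalValue_nonneg hmono S y
        nlinarith [mul_nonneg hβ (h2.trans h1)]
      · refine old t ht.1.1.1 ht.1.1.2 ?_ ?_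
        · rw [h.value t ht.1.1.1]
          exact hyθ.trans (hmin t ht.1)
        -- Another evicted candidate `t` still pays for `M l`: the only element chosen for `l` is
        -- `y`, so the removal of `t` is attributed elsewhere.
        · intro htC htl
          obtain ⟨l', hl', -, hct⟩ := hρC t htC
          obtain rfl : l = l' := Option.some_injective _ (htl.symm.trans hl')
          exact ht.2 (hct.symm.trans hcy)
    · refine (M l).subset_closure _ hground ?_
      rcases hyS with hyS | hyD
      · exact old y hyS hyE hyθ fun h1 h2 => hyC ⟨h1, h2⟩
      · have hyC' : y ∉ C := Finset.disjoint_left.1 hDC hyD.1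
        refine ⟨hyE, Or.inr ⟨Finset.mem_union_left _ hyD.1, ?_⟩, ?_⟩
        · rw [hρD y hyC']
          exact hyD.2
        · rwa [hv'D y (Finset.mem_union_left _ hyD.1)]

/-- The value of a feasible set all of whose elements are kept, removed or charged. -/
theorem PassInvariant.le_of_charged {p : ℕ} (hp : 1 ≤ p) (hM : IsMatchoid p M)
    (hf_nonneg : ∀ A, 0 ≤ f A) (hmono : Monotone f) (hsub : IsSubmodular f) (hβ : 0 < β)
    (h : PassInvariant f M β S₀ S D v ρ) {O : Finset X} (hO : Feasible M O)
    (hch : ∀ x ∈ O, x ∈ S.toFinset ∪ D ∨ Charged f M β S D v ρ x) :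
    f O ≤ (1 + p + p * β) * f S.toFinset +
      (p / β + p - 1) * (f S.toFinset - f S₀.toFinset) := by
  classical
  obtain ⟨A, hA⟩ : ∃ A, A = S.toFinset ∪ D := ⟨_, rfl⟩
  have hch' : ∀ x ∈ O \ A, Charged f M β S D v ρ x := by
    intro x hx
    rw [Finset.mem_sdiff] at hx
    exact (hch x hx.1).resolve_left (hA ▸ hx.2)
  choose! B w hw hcl using hch'
  rw [← hA] at hw
  have hvA : ∀ y ∈ A, 0 ≤ v y := by
    intro y hy
    rw [hA, Finset.mem_union, List.mem_toFinset] at hy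
    rcases hy with hy | hy
    · rw [h.value y hy]
      exact incrementalValue_nonneg hmono S y
    · exact h.nonneg y hy
  let J := (O \ A).biUnion B
  let P : ι → X → Prop := fun l y => y ∈ (M l).E ∧ (y ∈ S ∨ y ∈ D ∧ ρ y ≠ some l)
  have hmat : ∀ l ∈ J, ∑ x ∈ (O \ A).filter (fun x => l ∈ B x), w x l ≤
      ∑ y ∈ A.filter (P l), v y := by
    intro l _
    refine Matroid.Indep.sum_le_sum_of_mem_closure (N := M l) (w := fun x => w x l) ?_
      (fun y hy => hvA y (Finset.mem_filter.1 hy).1) ?_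
    · refine (hO l).subset fun x hx => ?_
      simp only [Finset.coe_filter, Finset.mem_sdiff, Set.mem_ofPred_eq] at hx
      exact ⟨hx.1.1, (M l).closure_subset_ground _ (hcl x (Finset.mem_sdiff.2 hx.1) l hx.2)⟩
    · intro x hx
      rw [Finset.mem_filter] at hx
      refine (M l).closure_subset_closure ?_ (hcl x hx.1 l hx.2)
      rintro y ⟨h1, h2, h3⟩
      refine ⟨Finset.mem_filter.2 ⟨?_, h1, h2⟩, h3⟩
      rw [hA, Finset.mem_union, List.mem_toFinset]
      exact h2.imp id And.left
  have hswap : ∑ x ∈ O \ A, ∑ l ∈ B x, w x l =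
      ∑ l ∈ J, ∑ x ∈ (O \ A).filter (fun x => l ∈ B x), w x l := by
    refine Finset.sum_comm' fun x l => ?_
    simp only [J, Finset.mem_filter, Finset.mem_biUnion]
    exact ⟨fun h => ⟨h, x, h⟩, fun h => h.1⟩
  have hswap' : ∑ l ∈ J, ∑ y ∈ A.filter (P l), v y =
      ∑ y ∈ A, ((J.filter fun l => P l y).card : ℝ) * v y := by
    rw [Finset.sum_comm' (t' := A) (s' := fun y => J.filter fun l => P l y)]
    · simp
    · intro l y
      simp only [Finset.mem_filter]
      tauto
  have hdisj : Disjoint S.toFinset D :=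
    Finset.disjoint_left.2 fun y hy => h.disjoint y (List.mem_toFinset.1 hy)
  have hbound : ∑ y ∈ A, ((J.filter fun l => P l y).card : ℝ) * v y ≤
      p * ∑ y ∈ S.toFinset, v y + (p - 1) * ∑ y ∈ D, v y := by
    rw [hA, Finset.sum_union hdisj, Finset.mul_sum, Finset.mul_sum]
    refine add_le_add (Finset.sum_le_sum fun y hy => ?_) (Finset.sum_le_sum fun y hy => ?_)
    · refine mul_le_mul_of_nonneg_right ?_ (hvA y (hA ▸ Finset.mem_union_left _ hy))
      have : (J.filter fun l => P l y).card ≤ p :=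
        hM.card_le (x := y) fun l hl => (Finset.mem_filter.1 hl).2.1
      exact_mod_cast this
    · refine mul_le_mul_of_nonneg_right ?_ (h.nonneg y hy)
      obtain ⟨k, hk, hyk⟩ := h.removed y hy
      have hρ : k ∉ J.filter fun l => P l y := by
        intro hl
        rcases (Finset.mem_filter.1 hl).2.2 with h1 | h1
        · exact h.disjoint y h1 hy
        · exact h1.2 hk
      -- The responsible matroid `k` contains `y` but is not paid by it, so at most `p - 1` matroids
      -- are.
      have : (insert k (J.filter fun l => P l y)).card ≤ p := by
        refine hM.card_le (x := y) fun l hl => ?_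
        rcases Finset.mem_insert.1 hl with rfl | hl
        · exact hyk
        · exact (Finset.mem_filter.1 hl).2.1
      rw [Finset.card_insert_of_notMem hρ] at this
      have : ((J.filter fun l => P l y).card : ℝ) + 1 ≤ p := by exact_mod_cast this
      linarith
  have hSv : ∑ y ∈ S.toFinset, v y ≤ f S.toFinset := by
    rw [Finset.sum_congr rfl fun y hy => h.value y (List.mem_toFinset.1 hy),
      sum_incrementalValue h.nodup]
    linarith [hf_nonneg ∅]
  have hfO : f O ≤ f A + ∑ x ∈ O \ A, marginal f x A := by
    refine le_trans (hmono ?_) (le_add_sum_marginal hmono hsub A (O \ A))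
    rw [Finset.union_sdiff_self_eq_union]
    exact Finset.subset_union_right
  have hmarg : ∑ x ∈ O \ A, marginal f x A ≤
      (1 + β) * (p * ∑ y ∈ S.toFinset, v y + (p - 1) * ∑ y ∈ D, v y) := by
    calc ∑ x ∈ O \ A, marginal f x A ≤ ∑ x ∈ O \ A, (1 + β) * ∑ l ∈ B x, w x l :=
          Finset.sum_le_sum hw
      _ ≤ _ := by
          rw [← Finset.mul_sum, hswap]
          exact mul_le_mul_of_nonneg_left
            ((Finset.sum_le_sum hmat).trans (hswap'.le.trans hbound)) (by linarith)
  have hunion := h.union_le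
  rw [← hA] at hunion
  obtain ⟨s, hs⟩ : ∃ s, s = ∑ y ∈ S.toFinset, v y := ⟨_, rfl⟩
  obtain ⟨u, hu⟩ : ∃ u, u = ∑ y ∈ D, v y := ⟨_, rfl⟩
  have hgain := h.gain
  rw [← hs] at hSv
  rw [← hs, ← hu] at hmarg
  rw [← hu] at hunion hgain
  have hu0 : 0 ≤ u := hu ▸ Finset.sum_nonneg h.nonneg
  have hΔ : u ≤ (f S.toFinset - f S₀.toFinset) / β := by
    rw [le_div_iff₀ hβ]
    linarith
  have hp' : (1 : ℝ) ≤ p := by exact_mod_cast hp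
  -- This is `1 + (1 + β) * (p - 1)`, the total coefficient of `u`: once from `hunion`, the rest
  -- from `hmarg`.
  have hk : 0 ≤ p + β * (p - 1) := by
    have := mul_nonneg hβ.le (by linarith : 0 ≤ (p : ℝ) - 1)
    linarith
  have hku := mul_le_mul_of_nonneg_left hΔ hk
  have hps := mul_le_mul_of_nonneg_left hSv (by positivity : 0 ≤ (1 + β) * (p : ℝ))
  have e : (p + β * (p - 1)) * ((f S.toFinset - f S₀.toFinset) / β) =
      (p / β + p - 1) * (f S.toFinset - f S₀.toFinset) := by
    field_simp
    ring
  rw [← e]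
  linarith

end Pass

theorem Feasible.card_le_matchoidRank {X ι : Type*} [Fintype X] {M : ι → Matroid X} {A : Finset X} (h : Feasible M A) :
    A.card ≤ matchoidRank M := by
  classical
  unfold matchoidRank
  exact Finset.le_sup (f := Finset.card) (by simpa using h)

/-- An arrival outside the initial solution must be new to both `m.sol` and `D`, since acceptance
would otherwise count it twice. With no candidates, `x` lies in the closure of the empty set, which
gives the loop alternative. -/
theorem PassInvariant.step {X ι : Type*} [DecidableEq X] {f : Finset X → ℝ}
    {M : ι → Matroid X} {p : ℕ} (hM : IsMatchoid p M) (hmono : Monotone f)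
    (hsub : IsSubmodular f) {β : ℝ} (hβ : 0 ≤ β) {m m' : Memory X} {x : X} {D : Finset X}
    {v : X → ℝ} {ρ : X → Option ι} (h : PassInvariant f M β m.init m.sol D v ρ)
    (hinit : ∀ y ∈ m.init, y ∈ m.sol.toFinset ∪ D)
    (hx : x ∉ m.init → x ∉ m.sol.toFinset ∪ D) (hs : Step f M 0 β m x m') :
    ∃ D' v' ρ', PassInvariant f M β m'.init m'.sol D' v' ρ' ∧ m'.init = m.init ∧
      m.sol.toFinset ∪ D ⊆ m'.sol.toFinset ∪ D' ∧
      m'.sol.toFinset ∪ D' ⊆ insert x (m.sol.toFinset ∪ D) ∧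
      (∀ l θ, payers M m.sol D v ρ l θ ⊆ (M l).closure (payers M m'.sol D' v' ρ' l θ)) ∧
      (x ∈ m'.sol.toFinset ∪ D' ∨ Charged f M β m'.sol D' v' ρ' x ∨
        ∃ l, (M l).IsLoop x) := by
  have hself : ∀ l θ, payers M m.sol D v ρ l θ ⊆ (M l).closure (payers M m.sol D v ρ l θ) :=
    fun l θ => (M l).subset_closure _ fun z hz => hz.1
  cases hs with
  | discard hx' =>
    exact ⟨D, v, ρ, h, rfl, subset_rfl, Finset.subset_insert _ _, hself, Or.inl (hinit x hx')⟩
  | reject C hx' hC hv =>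
    refine ⟨D, v, ρ, h, rfl, subset_rfl, Finset.subset_insert _ _, hself, Or.inr (Or.inl ?_)⟩
    exact h.charged_of_reject hM hmono hsub hβ hC (by linarith)
  | noExchange hx' hl =>
    refine ⟨D, v, ρ, h, rfl, subset_rfl, Finset.subset_insert _ _, hself, Or.inr (Or.inr ?_)⟩
    obtain ⟨l, hb, he⟩ := hl
    refine ⟨l, ?_⟩
    have := hb.mem_closure (by simpa using h.feasible l)
    rw [he] at this
    exact this
  | accept C hx' hC hv =>
    have hxSD := hx hx'
    rw [Finset.mem_union, not_or, List.mem_toFinset] at hxSD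
    obtain ⟨v', ρ', h', hp⟩ := h.accept hmono hsub hβ hC (by linarith) hxSD.1 hxSD.2
    refine ⟨D ∪ C, v', ρ', h', rfl, ?_, ?_, hp, Or.inl (by simp)⟩
    · intro y
      simp only [Finset.mem_union, List.mem_toFinset, List.mem_append, List.mem_filter,
        decide_eq_true_eq]
      tauto
    · intro y
      have := fun hy => hC.subset (y := y) hy
      simp only [Finset.mem_union, List.mem_toFinset, List.mem_append, List.mem_filter,
        decide_eq_true_eq, List.mem_singleton, Finset.mem_insert]
      tauto

/-! ### Existence of runs and the invariant along a pass -/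

section Run

variable {X ι : Type*} [Fintype X] [DecidableEq X] {f : Finset X → ℝ} {M : ι → Matroid X}

theorem exists_step (f : Finset X → ℝ) (M : ι → Matroid X) (α β : ℝ) (m : Memory X) (x : X) :
    ∃ m', Step f M α β m x m' := by
  classical
  by_cases hx : x ∈ m.init
  · exact ⟨_, .discard m x hx⟩
  by_cases h : ∃ l, Blocked M m.sol x l ∧ exchangeCandidates M m.sol x l = ∅
  · exact ⟨_, .noExchange m x hx h⟩
  push Not at h
  have hmin : ∀ l, ∃ c, Blocked M m.sol x l → c ∈ exchangeCandidates M m.sol x l ∧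
      ∀ t ∈ exchangeCandidates M m.sol x l,
        incrementalValue f m.sol c ≤ incrementalValue f m.sol t := by
    intro l
    by_cases hl : Blocked M m.sol x l
    · obtain ⟨c, hc⟩ := Set.exists_min_image _ (incrementalValue f m.sol)
        (Set.toFinite (exchangeCandidates M m.sol x l)) (h l hl)
      exact ⟨c, fun _ => hc⟩
    · exact ⟨x, fun h => absurd h hl⟩
  choose c hc using hmin
  have hC : IsExchange f M m.sol x
      (Finset.univ.filter fun y => ∃ l, Blocked M m.sol x l ∧ c l = y) :=
    ⟨c, hc, by simp⟩
  by_cases hv : marginal f x m.sol.toFinset ≥ α + (1 + β) * ∑ c ∈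
      (Finset.univ.filter fun y => ∃ l, Blocked M m.sol x l ∧ c l = y),
        incrementalValue f m.sol c
  · exact ⟨_, .accept m x _ hx hC hv⟩
  · exact ⟨_, .reject m x _ hx hC (not_le.1 hv)⟩

theorem exists_isStreamingLocalSearch (f : Finset X → ℝ) (M : ι → Matroid X) (α β : ℝ)
    (σ : Fin (Fintype.card X) ≃ X) (S₀ : List X) :
    ∃ (mem : ℕ → Memory X) (S : List X), IsStreamingLocalSearch f M α β σ S₀ mem S := by
  choose next hnext using exists_step f M α β
  let mem : ℕ → Memory X := fun t => Nat.rec ⟨S₀, S₀⟩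
    (fun t m => if h : t < Fintype.card X then next m (σ ⟨t, h⟩) else m) t
  refine ⟨mem, _, rfl, fun t => ?_, rfl⟩
  have : mem (t + 1) = next (mem t) (σ t) := by
    simp only [mem]
    rw [dif_pos t.2]
  rw [this]
  exact hnext _ _

theorem exists_isMultipassLocalSearch (f : Finset X → ℝ) (M : ι → Matroid X) (α : ℝ) (β : ℕ → ℝ)
    (d : ℕ) (σ : ℕ → (Fin (Fintype.card X) ≃ X)) :
    ∃ S mem, IsMultipassLocalSearch f M α β d σ S mem := by
  choose mem out h using fun i S₀ => exists_isStreamingLocalSearch f M α (β (i + 1)) (σ (i + 1)) S₀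
  let S : ℕ → List X := fun i => Nat.rec [] (fun i T => out i T) i
  exact ⟨S, fun i => mem (i - 1) (S (i - 1)), rfl, fun i _ => h i (S i)⟩

/-- The bookkeeping restarts with `D = ∅` in each pass. Recording that every element of the solution
or of `D` is initial or has already arrived guarantees that each new arrival is fresh. -/
theorem IsStreamingLocalSearch.exists_passInvariant {p : ℕ} (hM : IsMatchoid p M)
    (hmono : Monotone f) (hsub : IsSubmodular f) {β : ℝ} (hβ : 0 ≤ β)
    {σ : Fin (Fintype.card X) ≃ X} {S₀ S : List X} {mem : ℕ → Memory X} (hnd : S₀.Nodup)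
    (hS₀ : Feasible M S₀.toFinset)
    (h : IsStreamingLocalSearch f M 0 β σ S₀ mem S) :
    ∀ t ≤ Fintype.card X, ∃ D v ρ, PassInvariant f M β S₀ (mem t).sol D v ρ ∧
      (mem t).init = S₀ ∧ (∀ y ∈ S₀, y ∈ (mem t).sol.toFinset ∪ D) ∧
      (∀ y ∈ (mem t).sol.toFinset ∪ D, y ∈ S₀ ∨ (σ.symm y : ℕ) < t) ∧
      ∀ x, (σ.symm x : ℕ) < t → x ∈ (mem t).sol.toFinset ∪ D ∨
        Charged f M β (mem t).sol D v ρ x ∨ ∃ l, (M l).IsLoop x := by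
  obtain ⟨h0, hstep, -⟩ := h
  intro t
  induction t with
  | zero =>
    intro _
    rw [h0]
    exact ⟨∅, _, fun _ => none, .refl hnd hS₀ _, rfl, by simp, by simp, by simp⟩
  | succ t ih =>
    intro ht
    obtain ⟨D, v, ρ, hI, hin, hS, hold, hdone⟩ := ih (by omega)
    have hs := hstep ⟨t, by omega⟩
    obtain ⟨x, hx⟩ : ∃ x, x = σ ⟨t, by omega⟩ := ⟨_, rfl⟩
    have hxt : (σ.symm x : ℕ) = t := by simp [hx]
    rw [← hx] at hs
    obtain ⟨D', v', ρ', hI', hin', hsub1, hsub2, hp, hx'⟩ :=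
      PassInvariant.step hM hmono hsub hβ (by rwa [hin]) (by rwa [hin])
        (fun h1 h2 => (hold x h2).elim (hin ▸ h1) (by omega)) hs
    simp only at hI' hin' hsub1 hsub2 hp hx'
    rw [hin', hin] at hI'
    refine ⟨D', v', ρ', hI', hin'.trans hin, fun y hy => hsub1 (hS y hy), ?_, ?_⟩
    · intro y hy
      rcases Finset.mem_insert.1 (hsub2 hy) with rfl | hy
      · right
        omega
      · exact (hold y hy).imp id (by omega)
    · intro y hy
      rcases Nat.lt_succ_iff_lt_or_eq.1 hy with hy | hy
      · rcases hdone y hy with h1 | h1 | h1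
        · exact Or.inl (hsub1 h1)
        · exact Or.inr (Or.inl (h1.mono hmono hsub hsub1 hp))
        · exact Or.inr (Or.inr h1)
      · have : y = x := σ.symm.injective (Fin.ext (hy.trans hxt.symm))
        rwa [this]

end Run

/-! ### Combining the passes -/

section Multipass

variable {X ι : Type*} [Fintype X] [DecidableEq X] {f : Finset X → ℝ} {M : ι → Matroid X}
  {p : ℕ}

/-- One pass yields a feasible solution within the memory bound, whose value is controlled by that
of the initial solution. -/
theorem IsStreamingLocalSearch.guarantee (hp : 1 ≤ p) (hM : IsMatchoid p M)
    (hf_nonneg : ∀ A, 0 ≤ f A) (hmono : Monotone f) (hsub : IsSubmodular f) {β : ℝ} (hβ : 0 < β)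
    {σ : Fin (Fintype.card X) ≃ X} {S₀ S : List X} {mem : ℕ → Memory X} (hnd : S₀.Nodup)
    (hS₀ : Feasible M S₀.toFinset) (h : IsStreamingLocalSearch f M 0 β σ S₀ mem S) :
    S.Nodup ∧ Feasible M S.toFinset ∧
      (∀ O, Feasible M O → f O ≤ (1 + p + p * β) * f S.toFinset +
        (p / β + p - 1) * (f S.toFinset - f S₀.toFinset)) ∧
      ∀ t ≤ Fintype.card X, (mem t).size ≤ 2 * matchoidRank M := by
  have hinv := h.exists_passInvariant hM hmono hsub hβ.le hnd hS₀
  obtain ⟨D, v, ρ, hI, -, -, -, hdone⟩ := hinv _ le_rfl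
  rw [h.2.2] at hI hdone
  refine ⟨hI.nodup, hI.feasible, fun O hO => ?_, fun t ht => ?_⟩
  · refine hI.le_of_charged hp hM hf_nonneg hmono hsub hβ hO fun x hx => ?_
    rcases hdone x (σ.symm x).2 with h1 | h1 | ⟨l, hl⟩
    -- The loop alternative, treated last, cannot occur for an element of a feasible set.
    · exact Or.inl h1
    · exact Or.inr h1
    · exact hl.notMem_of_indep (hO l) ⟨hx, hl.mem_ground⟩ |>.elim
  · obtain ⟨D, v, ρ, hI, hin, -⟩ := hinv t ht
    have h1 := hS₀.card_le_matchoidRank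
    have h2 := hI.feasible.card_le_matchoidRank
    rw [List.toFinset_card_of_nodup hnd] at h1
    rw [List.toFinset_card_of_nodup hI.nodup] at h2
    rw [Memory.size, hin]
    omega

/-- After `i` passes, the solution has approximation ratio `γ i`. -/
theorem IsMultipassLocalSearch.guarantee (hp : 1 ≤ p) (hM : IsMatchoid p M)
    (hf_nonneg : ∀ A, 0 ≤ f A) (hmono : Monotone f) (hsub : IsSubmodular f)
    {γ β : ℕ → ℝ} (hγ_one : γ 1 = 4 * p)
    (hγ : ∀ i, 1 ≤ i → γ (i + 1) = 4 * p * (γ i * (γ i - 1) / (γ i - 1 + p) ^ 2))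
    (hβ_one : β 1 = 1)
    (hβ : ∀ i, 1 ≤ i → β (i + 1) = (γ i - 1 - p) / (γ i - 1 + p))
    {d : ℕ} {σ : ℕ → (Fin (Fintype.card X) ≃ X)} {S : ℕ → List X} {mem : ℕ → ℕ → Memory X}
    (h : IsMultipassLocalSearch f M 0 β d σ S mem) {i : ℕ} (hi : 1 ≤ i) (hid : i ≤ d) :
    (S i).Nodup ∧ Feasible M (S i).toFinset ∧
      (∀ O, Feasible M O → f O ≤ γ i * f (S i).toFinset) ∧
      ∀ t ≤ Fintype.card X, (mem i t).size ≤ 2 * matchoidRank M := by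
  have hp' : (1 : ℝ) ≤ p := by exact_mod_cast hp
  induction i, hi using Nat.le_induction with
  | base =>
    have hrun := h.2 0 (by omega)
    rw [h.1] at hrun
    obtain ⟨h1, h2, h3, h4⟩ := hrun.guarantee hp hM hf_nonneg hmono hsub
      (by rw [zero_add, hβ_one]; exact one_pos) List.nodup_nil
      (fun l => by simp)
    refine ⟨h1, h2, fun O hO => (h3 O hO).trans ?_, h4⟩
    rw [zero_add, hβ_one, hγ_one]
    -- With `β = 1` the coefficients `2 * p + 1` and `2 * p - 1` add up to `4 * p`; the leftover
    -- multiple of `f ∅` has the favourable sign.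
    have := mul_nonneg (by linarith : 0 ≤ 2 * (p : ℝ) - 1) (hf_nonneg ([] : List X).toFinset)
    linarith
  | succ i hi ih =>
    obtain ⟨h1, h2, h3, -⟩ := ih (by omega)
    have hg := (approximationRatio_bounds hp hγ_one hγ hi).1
    have hb : 0 < β (i + 1) := by
      rw [hβ i hi]
      exact div_pos (by linarith) (by linarith)
    obtain ⟨g1, g2, g3, g4⟩ := (h.2 i (by omega)).guarantee hp hM hf_nonneg hmono hsub hb h1 h2
    refine ⟨g1, g2, fun O hO => ?_, g4⟩
    rw [hγ i hi]
    exact ratio_step hp' hg (hβ i hi) (h3 O hO) (g3 O hO)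

end Multipass

theorem mainTheorem1 {X ι : Type*} [Fintype X] [DecidableEq X]
    (p : ℕ) (hp : 1 ≤ p) (M : ι → Matroid X) (hM : IsMatchoid p M)
    (f : Finset X → ℝ) (hf_nonneg : ∀ A, 0 ≤ f A) (hf_mono : Monotone f)
    (hf_sub : IsSubmodular f)
    (γ β : ℕ → ℝ) (hγ_one : γ 1 = 4 * p)
    (hγ : ∀ i, 1 ≤ i → γ (i + 1) = 4 * p * (γ i * (γ i - 1) / (γ i - 1 + p) ^ 2))
    (hβ_one : β 1 = 1)
    (hβ : ∀ i, 1 ≤ i → β (i + 1) = (γ i - 1 - p) / (γ i - 1 + p))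
    (d : ℕ) (σ : ℕ → (Fin (Fintype.card X) ≃ X)) :
    (∃ S mem, IsMultipassLocalSearch f M 0 β d σ S mem) ∧
    ∀ S mem, IsMultipassLocalSearch f M 0 β d σ S mem →
      (∀ i, 1 ≤ i → i ≤ d →
        Feasible M (S i).toFinset ∧
        (∀ O, IsOptimal f M O → f O ≤ (p + 1 + 4 * p / i) * f (S i).toFinset) ∧
        (∀ ε : ℝ, 0 < ε → 4 * p / ε ≤ i →
          ∀ O, IsOptimal f M O → f O ≤ (p + 1 + ε) * f (S i).toFinset) ∧
        ∀ t, t ≤ Fintype.card X → (mem i t).size ≤ 2 * matchoidRank M) := by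
  refine ⟨exists_isMultipassLocalSearch f M 0 β d σ, fun S mem h i hi hid => ?_⟩
  obtain ⟨-, h1, h2, h3⟩ :=
    h.guarantee hp hM hf_nonneg hf_mono hf_sub hγ_one hγ hβ_one hβ hi hid
  have hbound : ∀ O, IsOptimal f M O → f O ≤ (p + 1 + 4 * p / i) * f (S i).toFinset :=
    fun O hO => (h2 O hO.1).trans (mul_le_mul_of_nonneg_right
      (approximationRatio_bounds hp hγ_one hγ hi).2 (hf_nonneg _))
  refine ⟨h1, hbound, fun ε hε hεi O hO => (hbound O hO).trans ?_, h3⟩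
  refine mul_le_mul_of_nonneg_right (add_le_add le_rfl ?_) (hf_nonneg _)
  have hi' : (0 : ℝ) < i := by exact_mod_cast hi
  rw [div_le_iff₀ hε] at hεi
  rw [div_le_iff₀ hi']
  linarith
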